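/- Let $n\ge 1$, $r\ge 2$ and $s\ge 0$ be integers, let $\mathcal P=\{P_1,\dots,P_l\}$ be a partition of $[n]=\{1,\dots,n\}$ with $|P_i|\le r$ for all $i$, and let $\mathcal F$ be a family of non-empty subsets of $[n]$ such that $|F|>s$ for every $F\in\mathcal F$. Let $\widetilde{\mathrm{KG}}^r(\mathcal F,\mathcal P,s)$ be the $r$-uniform hypergraph whose vertices are the sets $A\in\mathcal F$ with $$\sum_{i=1}^l\max\{|A\cap P_i|-1,0\}\le\lfloor s/2\rfloor$$ and whose edges are the sets $\{A_1,\dots,A_r\}$ of $r$ distinct vertices with $|A_i\cap A_j|\le s$ for all $1\le i<j\le r$. Its chromatic number $\chi$ is the least number of colors in a coloring of the vertices without monochromatic edges. For an integer $s'\ge 0$ and $A,B\subseteq[n]$ write $A\subseteq_{s'}B$ if there is a set $E$ with $|E|\le s'$ and $A\setminus E\subseteq B$. Let $\mathrm{ecd}^r(\mathcal F,s')$ be the minimum size of a subset $X_0\subseteq[n]$ for which there is a partition $[n]\setminus X_0=X_1\cup\dots\cup X_r$ into pairwise disjoint, possibly empty sets with $\bigl||X_i|-|X_j|\bigr|\le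 1$ for all $i,j$, such that $F\subseteq_{s'}X_i$ holds for no $F\in\mathcal F$ and no $i\in\{1,\dots,r\}$. Then $$\chi\bigl(\widetilde{\mathrm{KG}}^r(\mathcal F,\mathcal P,s)\bigr)\ \ge\ \left\lceil\frac{\mathrm{ecd}^r(\mathcal F,\lfloor s/2\rfloor)}{r-1}\right\rceil .$$ -/

import Mathlib

/-- `H` is `t`-colorable: the vertices of `H` can be colored with `t` colors such that every edge
contains two vertices of different colors (no edge is monochromatic). -/
def Hypergraph.Colorable {V : Type*} (H : Hypergraph V) (t : ℕ) : Prop :=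
  ∃ c : H.vertexSet → Fin t, ∀ e ∈ H.edgeSet,
    ∃ x y : H.vertexSet, (x : V) ∈ e ∧ (y : V) ∈ e ∧ c x ≠ c y

/-- The chromatic number of `H`: the least `t` such that `H` is `t`-colorable, and `⊤` if there is
no such `t`. -/
noncomputable def Hypergraph.chromaticNumber {V : Type*} (H : Hypergraph V) : ℕ∞ :=
  ⨅ t ∈ {t : ℕ | H.Colorable t}, (t : ℕ∞)

/-- `A ⊆_s B`: there is a set `E` of size at most `s` such that `A \ E ⊆ B`. -/
def AlmostSubset {α : Type*} [DecidableEq α] (s : ℕ) (A B : Finset α) : Prop :=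
  ∃ E : Finset α, E.card ≤ s ∧ A \ E ⊆ B

/-- `X` is an equitable partition of the set `Y` into `r` (possibly empty) parts `X i`: the parts
are pairwise disjoint, their union is `Y`, and any two of their sizes differ by at most one. -/
def IsEquitablePartition {α : Type*} [DecidableEq α] {r : ℕ} (Y : Finset α)
    (X : Fin r → Finset α) : Prop :=
  (∀ i j, i ≠ j → Disjoint (X i) (X j)) ∧ Finset.univ.biUnion X = Y ∧
    ∀ i j, (X i).card ≤ (X j).card + 1

/-- The general equitable `r`-colorability defect `ecd^r(F, s)` of a family `F` of subsets of a
finite set: the minimum size of a subset `X₀` whose complement has an equitable partition into `r`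
parts `X i` such that `A ⊆_s X i` for no `A ∈ F` and no `i`. (Such an `X₀` exists whenever all
members of `F` have more than `s` elements: take the whole set.) -/
noncomputable def ecd {α : Type*} [Fintype α] [DecidableEq α] (r : ℕ) (F : Finset (Finset α))
    (s : ℕ) : ℕ :=
  sInf {k : ℕ | ∃ (X₀ : Finset α) (X : Fin r → Finset α), X₀.card = k ∧
    IsEquitablePartition X₀ᶜ X ∧ ∀ A ∈ F, ∀ i, ¬ AlmostSubset s A (X i)}

/-- The modified Kneser-type hypergraph. Its vertices are the `A ∈ F` with
`∑ max (|A ∩ p| - 1) 0 ≤ ⌊s / 2⌋`, where `p` ranges over the parts of `P` (the truncated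
subtraction of natural numbers is this maximum); its edges are the sets of `r` vertices any two
of which intersect in at most `s` elements. -/
def modifiedKneserHypergraph {α : Type*} [Fintype α] [DecidableEq α] (r : ℕ)
    (F : Finset (Finset α)) (P : Finpartition (Finset.univ : Finset α)) (s : ℕ) :
    Hypergraph (Finset α) where
  vertexSet := {A | A ∈ F ∧ ∑ p ∈ P.parts, ((A ∩ p).card - 1) ≤ s / 2}
  edgeSet := {e | e ⊆ {A | A ∈ F ∧ ∑ p ∈ P.parts, ((A ∩ p).card - 1) ≤ s / 2} ∧ e.encard = r ∧
    ∀ A ∈ e, ∀ B ∈ e, A ≠ B → (A ∩ B).card ≤ s}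
  subset_vertexSet_of_mem_edgeSet' := fun _ he => he.1

/-!
The lower bound comes from a `ZMod p`-equivariant Tucker lemma (`ZpTucker.card_le_of_labelling`):
suppose that every family `Z` of pairwise disjoint subsets of `N` indexed by `ZMod p`, not all
empty, gets a level in `{1, …, m}` and a sign in `ZMod p`, such that levels are monotone in `Z`,
comparable families on the same level have the same sign, and a shift of the index shifts the sign.
Then `|N| ≤ m`.

*The Tucker lemma.* A family is encoded as a sign vector, a list with entries in
`Option (ZMod p)`, that is, a simplex of the join of `|N|` copies of `ZMod p`. Over the field
`ZMod p`, two sequences are linked through the operators `D = τ - 1` and `Nm = 1 + τ + ⋯ + τ^(p-1)`,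
where `τ` is the shift. On the domain there are chains `c₀, c₁, …`, built by coning, with
`∂ c_{k+1} = T_k c_k`. On the signs there are cochains `Φ₀, Φ₁, …` with `δ Φ_k = T_k Φ_{k+1}`,
vanishing on sign sequences with two equal neighbours; `T_k` is alternately `D` and `Nm`. The
cochains exist because `ker D = im Nm` and `ker Nm = im D` on free modules
(`ZpTucker.exists_convOp_one_eq`, `ZpTucker.exists_convOp_diffWt_eq`). Evaluating along the
barycentric subdivision, the Stokes formula (`ZpTucker.chainSum_cobdry`) shows that the pairing of
`Nm Φ_k` with `c_k` does not depend on `k`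
(`ZpTucker.exists_reduced_fundChain_eq_one`); it is `1` for `k = 0`. But with fewer levels than
coordinates every full chain of sign vectors has two neighbours on the same level, hence with the
same sign, so the last pairing would be `0`.

*The combinatorial statement.* `TransversalPartitionProperty α ι` says: given upward closed
families `U c` of sets, one for each of `t` colours, and blocks of size at most `r = |ι|`, if every
equitable collection of `r` disjoint transversal subsets of `N` missing at most `(r - 1) t` points
has a member in some `U c`, then `r` disjoint subsets of `N` lie in one `U c`. For `r = p` prime, a
counterexample would give a labelling violating the Tucker lemma
(`TransversalPartitionProperty.zmod`): a family with a member in some `U c` is labelled by its top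
colour and the set of indices where it occurs, the others by the size of the largest equitable
transversal subfamily. The property passes to products of index types
(`TransversalPartitionProperty.prod`), hence holds for all `r ≥ 1`.

For the hypergraph, `U c` consists of the sets that contain a vertex of colour `c` up to at most
`⌊s / 2⌋` points. A member of `F` that is contained up to `⌊s / 2⌋` points in a transversal set is a
vertex, and two vertices almost contained in disjoint sets meet in at most `s` points.
-/

/-! ### Translation actions and convolution operators -/

/-- An additive monoid acts on lists entrywise. -/
instance List.addActionMap {G X : Type*} [AddMonoid G] [AddAction G X] : AddAction G (List X) where
  vadd g l := l.map (g +ᵥ ·)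
  zero_vadd l := by
    change l.map _ = l
    simp
  add_vadd g h l := by
    change l.map _ = (l.map _).map _
    simp [add_vadd]

/-- The entrywise action on `Option X`; `none` is fixed. -/
instance Option.addActionMap {G X : Type*} [AddMonoid G] [AddAction G X] :
    AddAction G (Option X) where
  zero_vadd o := by cases o <;> simp
  add_vadd g h o := by cases o <;> simp [add_vadd]

@[simp] lemma List.vadd_nil {G X : Type*} [AddMonoid G] [AddAction G X] (g : G) :
    g +ᵥ ([] : List X) = [] := rfl

@[simp] lemma List.vadd_cons {G X : Type*} [AddMonoid G] [AddAction G X] (g : G) (a : X)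
    (l : List X) : g +ᵥ (a :: l) = (g +ᵥ a) :: (g +ᵥ l) := rfl

@[simp] lemma List.length_vadd {G X : Type*} [AddMonoid G] [AddAction G X] (g : G)
    (l : List X) : (g +ᵥ l).length = l.length := List.length_map _

namespace ZpTucker

/-- The weight of the difference operator `D a = a (1 +ᵥ ·) - a`. -/
def diffWt (p : ℕ) : ZMod p → ZMod p := Pi.single 1 1 - Pi.single 0 1

/-- The weight `g ↦ -g`, whose operator `M` satisfies `D M = Nm`. -/
def momentWt (p : ℕ) : ZMod p → ZMod p := fun g => -g

/-- The weights of the operators `T_k`: difference for even `k`, norm (the constant `1`) for odd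
`k`. -/
def altWt (p : ℕ) (k : ℕ) : ZMod p → ZMod p := if Even k then diffWt p else 1

lemma altWt_even {k : ℕ} (hk : Even k) : altWt p k = diffWt p := if_pos hk

lemma altWt_odd {k : ℕ} (hk : ¬ Even k) : altWt p k = 1 := if_neg hk

section Operators

variable {p : ℕ} [Fact p.Prime] {X : Type*} [AddAction (ZMod p) X]

/-- The operator on functions on a `ZMod p`-set with weight `w`, an element of the group algebra.
The constant weight `1` gives the norm `Nm`. -/
def convOp (w : ZMod p → ZMod p) (a : X → ZMod p) (x : X) : ZMod p :=
  ∑ g, w g * a (g +ᵥ x)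

lemma convOp_diffWt (a : X → ZMod p) (x : X) :
    convOp (diffWt p) a x = a ((1 : ZMod p) +ᵥ x) - a x := by
  simp [convOp, diffWt, sub_mul, Finset.sum_sub_distrib, Pi.single_apply]

lemma convOp_one (a : X → ZMod p) (x : X) : convOp 1 a x = ∑ g : ZMod p, a (g +ᵥ x) := by
  simp [convOp]

lemma convOp_comm (w v : ZMod p → ZMod p) (a : X → ZMod p) :
    convOp w (convOp v a) = convOp v (convOp w a) := by
  funext x
  simp only [convOp, Finset.mul_sum]
  rw [Finset.sum_comm]
  refine Finset.sum_congr rfl fun g _ => Finset.sum_congr rfl fun h _ => ?_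
  rw [vadd_vadd, vadd_vadd, add_comm]
  ring

lemma convOp_one_vadd (a : X → ZMod p) (g : ZMod p) (x : X) :
    convOp 1 a (g +ᵥ x) = convOp 1 a x := by
  rw [convOp_one, convOp_one]
  exact Fintype.sum_equiv (Equiv.addRight g) _ _ fun h => by simp [vadd_vadd]

lemma convOp_diffWt_one (a : X → ZMod p) : convOp (diffWt p) (convOp 1 a) = 0 := by
  funext x
  rw [convOp_diffWt, convOp_one_vadd, sub_self, Pi.zero_apply]

lemma convOp_diffWt_momentWt (a : X → ZMod p) :
    convOp (diffWt p) (convOp (momentWt p) a) = convOp 1 a := by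
  funext x
  rw [convOp_diffWt, convOp_one]
  have h : convOp (momentWt p) a ((1 : ZMod p) +ᵥ x) = ∑ g : ZMod p, -(g - 1) * a (g +ᵥ x) := by
    exact Fintype.sum_equiv (Equiv.addRight 1) _ _ fun h => by simp [vadd_vadd, momentWt]
  rw [h, convOp, ← Finset.sum_sub_distrib]
  refine Finset.sum_congr rfl fun g _ => ?_
  simp only [momentWt]
  ring

lemma convOp_altWt_succ (k : ℕ) (a : X → ZMod p) :
    convOp (altWt p k) (convOp (altWt p (k + 1)) a) = 0 := by
  by_cases hk : Even k
  · rw [altWt_even hk, altWt_odd (by simpa [Nat.even_add_one] using hk), convOp_diffWt_one]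
  · rw [altWt_odd hk, altWt_even (by simpa [Nat.even_add_one] using hk), convOp_comm,
      convOp_diffWt_one]

end Operators

/-! ### Sign vectors, chains and the Stokes formula -/

section SignVectors

variable {p : ℕ}

/-- The value of a function `a` on the simplicial boundary of the sign vector `x`: the alternating
sum of `a` over the vectors obtained from `x` by replacing one entry `some g` by `none`. The head of
the list comes with sign `+`. -/
def bdry : List (Option (ZMod p)) → (List (Option (ZMod p)) → ZMod p) → ZMod p
  | [], _ => 0
  | none :: x, a => bdry x fun y => a (none :: y)
  | some g :: x, a => a (none :: x) - bdry x fun y => a (some g :: y)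

/-- The simplicial coboundary of the cochain `Φ` on sequences of signs of arbitrary length,
including the empty one. -/
def cobdry : List (ZMod p) → (List (ZMod p) → ZMod p) → ZMod p
  | [], _ => 0
  | g :: l, Φ => Φ l - cobdry l fun l' => Φ (g :: l')

/-- The signed sum of `Φ (s x₁, …, s x_k)` over all chains `x = x₁ > x₂ > ⋯ > x_k` of sign vectors
in which each is obtained from the preceding one by deleting one entry: evaluation of `Φ` on the
barycentric subdivision of the simplex `x` when `x` has `k` entries different from `none`. -/
def chainSum (s : List (Option (ZMod p)) → ZMod p) :
    ℕ → (List (ZMod p) → ZMod p) → List (Option (ZMod p)) → ZMod p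
  | 0, Φ, _ => Φ []
  | k + 1, Φ, x => bdry x (chainSum s k fun l => Φ (s x :: l))

/-! Linearity of the boundary, the coboundary and the evaluation. -/

lemma bdry_sum {ι : Type*} [Fintype ι] (w : ι → ZMod p)
    (a : ι → List (Option (ZMod p)) → ZMod p) (x : List (Option (ZMod p))) :
    bdry x (fun y => ∑ i, w i * a i y) = ∑ i, w i * bdry x (a i) := by
  induction x generalizing a with
  | nil => simp [bdry]
  | cons o x ih =>
    cases o with
    | none => simp only [bdry]; exact ih fun i y => a i (none :: y)
    | some g =>
      simp only [bdry, mul_sub, Finset.sum_sub_distrib]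
      rw [ih fun i y => a i (some g :: y)]

lemma bdry_zero (x : List (Option (ZMod p))) : bdry x (fun _ => 0) = 0 := by
  simpa using bdry_sum (ι := Empty) (fun _ => 0) (fun _ _ => 0) x

lemma bdry_sub (a b : List (Option (ZMod p)) → ZMod p) (x : List (Option (ZMod p))) :
    bdry x (fun y => a y - b y) = bdry x a - bdry x b := by
  have := bdry_sum (ι := Bool) (fun i => cond i 1 (-1)) (fun i => cond i a b) x
  simpa [sub_eq_add_neg] using this

lemma cobdry_sum {ι : Type*} [Fintype ι] (w : ι → ZMod p)
    (Φ : ι → List (ZMod p) → ZMod p) (l : List (ZMod p)) :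
    cobdry l (fun y => ∑ i, w i * Φ i y) = ∑ i, w i * cobdry l (Φ i) := by
  induction l generalizing Φ with
  | nil => simp [cobdry]
  | cons g l ih =>
    simp only [cobdry, mul_sub, Finset.sum_sub_distrib]
    rw [ih fun i y => Φ i (g :: y)]

lemma cobdry_zero (l : List (ZMod p)) : cobdry l (fun _ => 0) = 0 := by
  simpa using cobdry_sum (ι := Empty) (fun _ => 0) (fun _ _ => 0) l

lemma cobdry_sub (Φ Ψ : List (ZMod p) → ZMod p) (l : List (ZMod p)) :
    cobdry l (fun y => Φ y - Ψ y) = cobdry l Φ - cobdry l Ψ := by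
  have := cobdry_sum (ι := Bool) (fun i => cond i 1 (-1)) (fun i => cond i Φ Ψ) l
  simpa [sub_eq_add_neg] using this

lemma chainSum_sum (s : List (Option (ZMod p)) → ZMod p) {ι : Type*} [Fintype ι] (w : ι → ZMod p)
    (Φ : ι → List (ZMod p) → ZMod p) (k : ℕ) (x : List (Option (ZMod p))) :
    chainSum s k (fun l => ∑ i, w i * Φ i l) x = ∑ i, w i * chainSum s k (Φ i) x := by
  induction k generalizing Φ x with
  | zero => simp [chainSum]
  | succ k ih =>
    simp only [chainSum]
    rw [← bdry_sum]
    congr 1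
    funext y
    exact ih (fun i l => Φ i (s x :: l)) y

lemma chainSum_zero (s : List (Option (ZMod p)) → ZMod p) (k : ℕ) (x : List (Option (ZMod p))) :
    chainSum s k (fun _ => 0) x = 0 := by
  simpa using chainSum_sum s (ι := Empty) (fun _ => 0) (fun _ _ => 0) k x

lemma chainSum_sub (s : List (Option (ZMod p)) → ZMod p) (Φ Ψ : List (ZMod p) → ZMod p) (k : ℕ)
    (x : List (Option (ZMod p))) :
    chainSum s k (fun y => Φ y - Ψ y) x = chainSum s k Φ x - chainSum s k Ψ x := by
  have := chainSum_sum s (ι := Bool) (fun i => cond i 1 (-1)) (fun i => cond i Φ Ψ) k x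
  simpa [sub_eq_add_neg] using this

lemma bdry_bdry (a : List (Option (ZMod p)) → ZMod p) (x : List (Option (ZMod p))) :
    bdry x (fun y => bdry y a) = 0 := by
  induction x generalizing a with
  | nil => rfl
  | cons o x ih =>
    cases o with
    | none => simp only [bdry]; exact ih _
    | some g => simp only [bdry]; rw [bdry_sub, ih, sub_zero, sub_self]

lemma cobdry_cobdry (Φ : List (ZMod p) → ZMod p) (l : List (ZMod p)) :
    cobdry l (fun l' => cobdry l' Φ) = 0 := by
  induction l generalizing Φ with
  | nil => rfl
  | cons g l ih => simp only [cobdry]; rw [cobdry_sub, ih, sub_zero, sub_self]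

/-- Stokes formula: evaluation along barycentric subdivisions turns the coboundary into the
boundary. The inner faces of the subdivision cancel because the boundary squares to zero. -/
lemma chainSum_cobdry (s : List (Option (ZMod p)) → ZMod p) (k : ℕ)
    (Φ : List (ZMod p) → ZMod p) (x : List (Option (ZMod p))) :
    chainSum s (k + 1) (fun l => cobdry l Φ) x = bdry x (chainSum s k Φ) := by
  induction k generalizing Φ x with
  | zero => simp [chainSum, cobdry]
  | succ k ih =>
    rw [chainSum]
    simp only [cobdry]
    have : (chainSum s (k + 1) fun l => Φ l - cobdry l fun l' => Φ (s x :: l')) =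
        fun y => chainSum s (k + 1) Φ y - bdry y (chainSum s k fun l' => Φ (s x :: l')) := by
      funext y
      rw [chainSum_sub, ih]
    rw [this, bdry_sub, bdry_bdry, sub_zero]

/-- `y` arises from the sign vector `x` by replacing some entries by `none`. -/
def IsFace (y x : List (Option (ZMod p))) : Prop :=
  List.Forall₂ (fun u v => u = none ∨ u = v) y x

lemma IsFace.refl (x : List (Option (ZMod p))) : IsFace x x :=
  List.forall₂_same.2 fun _ _ => Or.inr rfl

lemma IsFace.length {y x : List (Option (ZMod p))} (h : IsFace y x) : y.length = x.length :=
  List.Forall₂.length_eq h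

lemma bdry_congr {a b : List (Option (ZMod p)) → ZMod p} (x : List (Option (ZMod p)))
    (h : ∀ y, IsFace y x → a y = b y) : bdry x a = bdry x b := by
  induction x generalizing a b with
  | nil => rfl
  | cons o x ih =>
    cases o with
    | none => exact ih fun y hy => h _ (.cons (Or.inl rfl) hy)
    | some g =>
      simp only [bdry]
      rw [h _ (.cons (Or.inl rfl) (IsFace.refl x)),
        ih fun y hy => h _ (.cons (Or.inr rfl) hy)]

lemma bdry_eq_zero_of_forall_none (x : List (Option (ZMod p))) (hx : ∀ g, some g ∉ x)
    (a : List (Option (ZMod p)) → ZMod p) : bdry x a = 0 := by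
  induction x generalizing a with
  | nil => rfl
  | cons o x ih =>
    cases o with
    | none => exact ih (fun g hg => hx g (by simp [hg])) _
    | some g => exact absurd (by simp) (hx g)

lemma chainSum_none_cons {s : List (Option (ZMod p)) → ZMod p} (hs : ∀ x, s (none :: x) = s x)
    (k : ℕ) (Φ : List (ZMod p) → ZMod p) (x : List (Option (ZMod p))) :
    chainSum s k Φ (none :: x) = chainSum s k Φ x := by
  induction k generalizing Φ x with
  | zero => rfl
  | succ k ih =>
    simp only [chainSum, bdry, hs]
    congr 1
    funext y
    exact ih _ y

variable [Fact p.Prime]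

lemma bdry_vadd (g : ZMod p) (x : List (Option (ZMod p))) (a : List (Option (ZMod p)) → ZMod p) :
    bdry (g +ᵥ x) a = bdry x fun y => a (g +ᵥ y) := by
  induction x generalizing a with
  | nil => rfl
  | cons o x ih =>
    cases o with
    | none => exact ih _
    | some h => exact congrArg (a (none :: (g +ᵥ x)) - ·) (ih _)

lemma bdry_convOp (w : ZMod p → ZMod p) (a : List (Option (ZMod p)) → ZMod p)
    (x : List (Option (ZMod p))) :
    bdry x (convOp w a) = convOp w (fun y => bdry y a) x := by
  simp only [convOp, bdry_vadd]
  exact bdry_sum w (fun g y => a (g +ᵥ y)) x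

lemma cobdry_vadd (g : ZMod p) (l : List (ZMod p)) (Φ : List (ZMod p) → ZMod p) :
    cobdry (g +ᵥ l) Φ = cobdry l fun y => Φ (g +ᵥ y) := by
  induction l generalizing Φ with
  | nil => rfl
  | cons h l ih => exact congrArg (Φ (g +ᵥ l) - ·) (ih _)

lemma cobdry_convOp (w : ZMod p → ZMod p) (Φ : List (ZMod p) → ZMod p) (l : List (ZMod p)) :
    cobdry l (convOp w Φ) = convOp w (fun y => cobdry y Φ) l := by
  simp only [convOp, cobdry_vadd]
  exact cobdry_sum w (fun g y => Φ (g +ᵥ y)) l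

lemma chainSum_vadd {s : List (Option (ZMod p)) → ZMod p} {n : ℕ}
    (hs : ∀ x g h, x.length ≤ n → some h ∈ x → s (g +ᵥ x) = g + s x) (k : ℕ)
    (Φ : List (ZMod p) → ZMod p) (g : ZMod p) (x : List (Option (ZMod p))) (hx : x.length ≤ n) :
    chainSum s k Φ (g +ᵥ x) = chainSum s k (fun l => Φ (g +ᵥ l)) x := by
  induction k generalizing Φ x with
  | zero => rfl
  | succ k ih =>
    simp only [chainSum]
    rw [bdry_vadd]
    by_cases h : ∃ h, some h ∈ x
    · obtain ⟨h, hh⟩ := h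
      refine bdry_congr _ fun y hy => ?_
      rw [ih _ _ (hy.length ▸ hx), hs x g h hx hh]
      rfl
    · push Not at h
      rw [bdry_eq_zero_of_forall_none _ h, bdry_eq_zero_of_forall_none _ h]

lemma convOp_chainSum {s : List (Option (ZMod p)) → ZMod p} {n : ℕ}
    (hs : ∀ x g h, x.length ≤ n → some h ∈ x → s (g +ᵥ x) = g + s x) (k : ℕ)
    (w : ZMod p → ZMod p) (Φ : List (ZMod p) → ZMod p) (x : List (Option (ZMod p)))
    (hx : x.length ≤ n) :
    convOp w (chainSum s k Φ) x = chainSum s k (convOp w Φ) x := by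
  refine .trans ?_ (chainSum_sum s w (fun g l => Φ (g +ᵥ l)) k x).symm
  exact Finset.sum_congr rfl fun g _ => by rw [chainSum_vadd hs k Φ g x hx]

/-- Evaluation on the chain `c_k` of sign vectors of length `k + 1`, where `c₀` is the vertex `0`
and `c_{k+1}` is the cone over `T_k c_k` with apex `0` in a new coordinate. -/
def fundChain : ℕ → (List (Option (ZMod p)) → ZMod p) → ZMod p
  | 0, a => a [some 0]
  | k + 1, a => fundChain k (convOp (altWt p k) fun y => a (some 0 :: y))

lemma fundChain_congr (k : ℕ) {a b : List (Option (ZMod p)) → ZMod p}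
    (h : ∀ x, x.length = k + 1 → a x = b x) : fundChain k a = fundChain k b := by
  induction k generalizing a b with
  | zero => exact h _ rfl
  | succ k ih =>
    refine ih fun x hx => ?_
    simp only [convOp]
    exact Finset.sum_congr rfl fun g _ => by rw [h _ (by simp [hx])]

lemma fundChain_sub (k : ℕ) (a b : List (Option (ZMod p)) → ZMod p) :
    fundChain k (fun x => a x - b x) = fundChain k a - fundChain k b := by
  induction k generalizing a b with
  | zero => rfl
  | succ k ih =>
    simp only [fundChain]
    rw [← ih]
    congr 1
    funext x
    simp only [convOp, mul_sub, Finset.sum_sub_distrib]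

lemma fundChain_zero (k : ℕ) : fundChain (p := p) k (fun _ => 0) = 0 := by
  simpa using fundChain_sub (p := p) k (fun _ => 0) (fun _ => 0)

/-- `∂ c_{k+1} = T_k c_k`, with sign vectors of length `k + 1` padded by `none`. The remaining term,
the cone over the boundary of `T_k c_k`, vanishes since `T_{k-1} T_k = 0`. -/
lemma fundChain_bdry (k : ℕ) (a : List (Option (ZMod p)) → ZMod p) :
    fundChain (k + 1) (fun x => bdry x a) =
      fundChain k (convOp (altWt p k) fun y => a (none :: y)) := by
  have key : ∀ (k : ℕ) (a : List (Option (ZMod p)) → ZMod p),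
      fundChain (k + 1) (fun x => bdry x a) =
      fundChain k (convOp (altWt p k) fun y => a (none :: y)) -
        fundChain k (fun x => bdry x (convOp (altWt p k) fun y => a (some 0 :: y))) := by
    intro k a
    rw [← fundChain_sub]
    simp only [fundChain]
    congr 1
    funext x
    rw [bdry_convOp]
    simp only [convOp, bdry, mul_sub, Finset.sum_sub_distrib]
  induction k generalizing a with
  | zero =>
    rw [key, sub_eq_self]
    simp only [fundChain, bdry, sub_zero]
    rw [altWt_even Even.zero, convOp_diffWt]
    exact sub_self _
  | succ k ih =>
    rw [key, sub_eq_self, ih]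
    have : (fun y => convOp (altWt p (k + 1)) (fun y => a (some 0 :: y)) (none :: y)) =
        convOp (altWt p (k + 1)) (fun y => a (some 0 :: none :: y)) := rfl
    rw [this, convOp_altWt_succ]
    exact fundChain_zero k

end SignVectors

/-! ### Families of disjoint sets as sign vectors -/

section Labelling

variable {p : ℕ}

/-- The sets `Z i` are pairwise disjoint subsets of `N`; they may be empty. -/
def IsDisjointFamily {α ι : Type*} (N : Finset α) (Z : ι → Finset α) : Prop :=
  (∀ i, Z i ⊆ N) ∧ Pairwise (Function.onFun Disjoint Z)

/-- The family encoded by a sign vector: `v j` belongs to the member with index `i` if the entry at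
position `j`, counted from the end of the list, is `some i`. Counting from the end makes padding by
`none` at the head invisible. -/
def toFamily {α : Type*} [DecidableEq α] (v : ℕ → α) :
    List (Option (ZMod p)) → ZMod p → Finset α
  | [], _ => ∅
  | none :: x, i => toFamily v x i
  | some g :: x, i => if i = g then insert (v x.length) (toFamily v x i) else toFamily v x i

section Families

variable {α : Type*} [DecidableEq α] {v : ℕ → α}

lemma exists_of_mem_toFamily {x : List (Option (ZMod p))} {i : ZMod p} {a : α}
    (h : a ∈ toFamily v x i) : ∃ j < x.length, a = v j := by
  induction x with
  | nil => simp [toFamily] at h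
  | cons o x ih =>
    have aux : a ∈ toFamily v x i → ∃ j < (o :: x).length, a = v j := fun h =>
      (ih h).imp fun j hj => ⟨hj.1.trans (Nat.lt_succ_self _), hj.2⟩
    cases o with
    | none => exact aux h
    | some g =>
      simp only [toFamily] at h
      split_ifs at h
      · rcases Finset.mem_insert.1 h with rfl | h
        · exact ⟨x.length, Nat.lt_succ_self _, rfl⟩
        · exact aux h
      · exact aux h

lemma disjoint_toFamily {x : List (Option (ZMod p))} {n : ℕ} (hv : Set.InjOn v (Set.Iio n))
    (hx : x.length ≤ n) : Pairwise (Function.onFun Disjoint (toFamily (p := p) v x)) := by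
  induction x with
  | nil => intro i j _; simp [toFamily, Function.onFun]
  | cons o x ih =>
    have hx' : x.length < n := hx
    cases o with
    | none => exact ih hx'.le
    | some g =>
      have hnew : ∀ i, v x.length ∉ toFamily v x i := fun i hi => by
        obtain ⟨j, hj, hvj⟩ := exists_of_mem_toFamily hi
        exact hj.ne (hv hx' (Set.mem_Iio.2 (hj.trans hx')) hvj).symm
      intro i j hij
      have := ih hx'.le hij
      simp only [Function.onFun, toFamily] at this ⊢
      split_ifs with h1 h2
      · exact absurd (h1.trans h2.symm) hij
      · exact Finset.disjoint_insert_left.2 ⟨hnew j, this⟩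
      · exact Finset.disjoint_insert_right.2 ⟨hnew i, this⟩
      · exact this

lemma toFamily_vadd (g : ZMod p) (x : List (Option (ZMod p))) :
    toFamily v (g +ᵥ x) = fun i => toFamily v x (i - g) := by
  induction x with
  | nil => rfl
  | cons o x ih =>
    funext i
    cases o with
    | none => exact congrFun ih i
    | some h =>
      change toFamily v (some (g + h) :: (g +ᵥ x)) i = _
      simp only [toFamily, ih, List.length_vadd, sub_eq_iff_eq_add']

lemma toFamily_mono {x y : List (Option (ZMod p))} (h : IsFace y x) :
    toFamily v y ≤ toFamily v x := by
  induction h with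
  | nil => exact le_rfl
  | @cons u w y x huw hyx ih =>
    intro i
    rcases huw with rfl | rfl
    · cases w with
      | none => exact ih i
      | some g =>
        simp only [toFamily]
        split_ifs
        · exact (ih i).trans (Finset.subset_insert _ _)
        · exact ih i
    · cases u with
      | none => exact ih i
      | some g =>
        simp only [toFamily, IsFace.length hyx]
        split_ifs
        · exact Finset.insert_subset_insert _ (ih i)
        · exact ih i

lemma toFamily_nonempty {x : List (Option (ZMod p))} {g : ZMod p} (h : some g ∈ x) :
    (toFamily v x g).Nonempty := by
  induction x with
  | nil => simp at h
  | cons o x ih =>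
    cases o with
    | none => exact ih (by simpa using h)
    | some g' =>
      simp only [toFamily]
      split_ifs with hg
      · exact Finset.insert_nonempty _ _
      · exact ih (by simpa [hg] using h)

end Families

/-! ### Cochains of signs -/

/-- The cochain `Φ` vanishes on all sequences in which two neighbours are equal. -/
def Reduced (Φ : List (ZMod p) → ZMod p) : Prop := ∀ l, ¬ l.IsChain (· ≠ ·) → Φ l = 0

lemma Reduced.cobdry {Φ : List (ZMod p) → ZMod p} (hΦ : Reduced Φ) :
    Reduced fun l => cobdry l Φ := by
  intro l hl
  induction l generalizing Φ with
  | nil => rfl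
  | cons g l ih =>
    simp only [ZpTucker.cobdry]
    by_cases h : l.IsChain (· ≠ ·)
    · cases l with
      | nil => simp at hl
      | cons g' l =>
        have hg : g = g' := by
          by_contra hne
          exact hl (List.isChain_cons_cons.2 ⟨hne, h⟩)
        subst hg
        have : (fun l' => Φ (g :: g :: l')) = fun _ => 0 := by
          funext l'
          exact hΦ _ (by simp)
        simp only [ZpTucker.cobdry]
        rw [this, cobdry_zero, sub_zero, sub_self]
    · rw [hΦ l h, zero_sub, neg_eq_zero]
      exact ih (fun l' hl' => hΦ _ fun hc => hl' (List.IsChain.tail hc)) h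

variable [Fact p.Prime]

lemma isChain_ne_vadd (g : ZMod p) (l : List (ZMod p)) :
    (g +ᵥ l).IsChain (· ≠ ·) ↔ l.IsChain (· ≠ ·) := by
  change (l.map _).IsChain _ ↔ _
  rw [List.isChain_map]
  simp

lemma Reduced.convOp {Φ : List (ZMod p) → ZMod p} (hΦ : Reduced Φ) (w : ZMod p → ZMod p) :
    Reduced (convOp w Φ) := by
  intro l hl
  refine Finset.sum_eq_zero fun g _ => ?_
  rw [hΦ _ (mt (isChain_ne_vadd g l).1 hl), mul_zero]

/-- `ker D ⊆ im Nm`: keep the values on the sequences that start with `0`, one from each orbit. -/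
lemma exists_convOp_one_eq {ψ : List (ZMod p) → ZMod p} (hψ : Reduced ψ) (hnil : ψ [] = 0)
    (hD : convOp (diffWt p) ψ = 0) : ∃ Φ, Reduced Φ ∧ convOp 1 Φ = ψ := by
  have h1 : ∀ l, ψ ((1 : ZMod p) +ᵥ l) = ψ l := fun l => by
    have := congrFun hD l
    rwa [convOp_diffWt, Pi.zero_apply, sub_eq_zero] at this
  have hinv : ∀ (g : ZMod p) l, ψ (g +ᵥ l) = ψ l := by
    have hnat : ∀ (i : ℕ) l, ψ ((i : ZMod p) +ᵥ l) = ψ l := by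
      intro i
      induction i with
      | zero => intro l; simp
      | succ i ih => intro l; rw [Nat.cast_succ, add_comm, ← vadd_vadd, h1, ih]
    intro g l
    rw [← ZMod.natCast_zmod_val g, hnat]
  refine ⟨fun l => if l.head? = some 0 then ψ l else 0, fun l hl => ?_, ?_⟩
  · simp [hψ l hl]
  · funext l
    rw [convOp_one]
    cases l with
    | nil => simp [hnil]
    | cons g l =>
      simp only [List.vadd_cons, List.head?_cons, Option.some.injEq, vadd_eq_add,
        add_eq_zero_iff_eq_neg]
      rw [Finset.sum_ite_eq' Finset.univ (-g), if_pos (Finset.mem_univ _)]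
      exact hinv (-g) (g :: l)

/-- `ker Nm ⊆ im D`: sum along each orbit, starting from the sequence that begins with `0`. -/
lemma exists_convOp_diffWt_eq {ψ : List (ZMod p) → ZMod p} (hψ : Reduced ψ) (hnil : ψ [] = 0)
    (hN : convOp 1 ψ = 0) : ∃ Φ, Reduced Φ ∧ convOp (diffWt p) Φ = ψ := by
  have hp := (Fact.out : p.Prime).pos
  refine ⟨fun l => ∑ i ∈ Finset.range (l.headD 0).val, ψ (((i : ZMod p) - l.headD 0) +ᵥ l),
    fun l hl => ?_, ?_⟩
  · exact Finset.sum_eq_zero fun i _ => hψ _ (mt (isChain_ne_vadd _ l).1 hl)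
  · funext l
    rw [convOp_diffWt]
    cases l with
    | nil => simp [hnil]
    | cons g l =>
      have hshift : ∀ i : ZMod p, (i - (1 + g)) +ᵥ ((1 : ZMod p) +ᵥ (g :: l)) =
          (i - g) +ᵥ (g :: l) := fun i => by
        rw [vadd_vadd]
        congr 1
        ring
      have hl : ((1 : ZMod p) +ᵥ (g :: l)).headD 0 = 1 + g := rfl
      simp only [hl, hshift, List.headD_cons]
      by_cases hg : g.val + 1 < p
      · have : (1 + g).val = g.val + 1 := by
          rw [add_comm, ZMod.val_add_of_lt] <;> rw [ZMod.val_one'' (by omega)]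
          exact hg
        rw [this, Finset.sum_range_succ, add_sub_cancel_left, ZMod.natCast_zmod_val, sub_self,
          zero_vadd]
      -- Wrapping around the orbit: the missing terms form a full orbit sum, which is zero.
      · have hval : g.val + 1 = p := by have := g.val_lt; omega
        have hg1 : (1 : ZMod p) + g = 0 := by
          rw [← ZMod.natCast_zmod_val g, add_comm]
          exact_mod_cast (by rw [hval]; simp : ((g.val + 1 : ℕ) : ZMod p) = 0)
        have hsum : ∑ i ∈ Finset.range (g.val + 1), ψ (((i : ZMod p) - g) +ᵥ (g :: l)) = 0 := by
          rw [hval]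
          have h0 := congrFun hN (g :: l)
          rw [convOp_one, Pi.zero_apply] at h0
          rw [← h0, ← Equiv.sum_comp (Equiv.subRight g)]
          refine Finset.sum_bij (fun i _ => (i : ZMod p)) (fun _ _ => Finset.mem_univ _) ?_ ?_ ?_
          · intro i hi j hj hij
            have := congrArg ZMod.val hij
            rwa [ZMod.val_cast_of_lt (Finset.mem_range.1 hi),
              ZMod.val_cast_of_lt (Finset.mem_range.1 hj)] at this
          · intro x _
            exact ⟨x.val, Finset.mem_range.2 x.val_lt, ZMod.natCast_zmod_val x⟩
          · intro i _
            rfl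
        rw [Finset.sum_range_succ, ZMod.natCast_zmod_val, sub_self, zero_vadd] at hsum
        rw [hg1, ZMod.val_zero, Finset.sum_range_zero, zero_sub, neg_eq_iff_add_eq_zero]
        exact hsum

/-- One step `δ Φ_k = T_k Φ_{k+1}` in the construction of the cochains. -/
lemma exists_next_cochain (k : ℕ) {Φ : List (ZMod p) → ZMod p} (hΦ : Reduced Φ)
    (h : convOp (altWt p (k + 1)) (fun l => cobdry l Φ) = 0) :
    ∃ Ψ, Reduced Ψ ∧ convOp (altWt p k) Ψ = (fun l => cobdry l Φ) ∧
      convOp (altWt p (k + 2)) (fun l => cobdry l Ψ) = 0 := by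
  have hk : altWt p (k + 2) = altWt p k := by simp [altWt, Nat.even_add]
  obtain ⟨Ψ, h1, h2⟩ : ∃ Ψ, Reduced Ψ ∧ convOp (altWt p k) Ψ = fun l => cobdry l Φ := by
    by_cases he : Even k
    · rw [altWt_odd (by simpa [Nat.even_add_one] using he)] at h
      rw [altWt_even he]
      exact exists_convOp_diffWt_eq hΦ.cobdry rfl h
    · rw [altWt_even (by simpa [Nat.even_add_one] using he)] at h
      rw [altWt_odd he]
      exact exists_convOp_one_eq hΦ.cobdry rfl h
  refine ⟨Ψ, h1, h2, ?_⟩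
  funext l
  rw [hk, ← cobdry_convOp, h2, cobdry_cobdry, Pi.zero_apply]

lemma fundChain_chainSum_cobdry {s : List (Option (ZMod p)) → ZMod p} {n : ℕ}
    (hnone : ∀ x, s (none :: x) = s x)
    (hs : ∀ x g h, x.length ≤ n → some h ∈ x → s (g +ᵥ x) = g + s x) {k : ℕ} (hk : k + 1 ≤ n)
    (Φ : List (ZMod p) → ZMod p) :
    fundChain (k + 1) (chainSum s (k + 2) fun l => cobdry l Φ) =
      fundChain k (chainSum s (k + 1) (convOp (altWt p k) Φ)) := by
  have : (chainSum s (k + 2) fun l => cobdry l Φ) = fun x => bdry x (chainSum s (k + 1) Φ) := by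
    funext x
    exact chainSum_cobdry s (k + 1) Φ x
  rw [this, fundChain_bdry]
  simp only [chainSum_none_cons hnone]
  exact fundChain_congr k fun x hx => convOp_chainSum hs _ _ _ _ (hx ▸ hk)

/-- There is a reduced cochain `Φ_k` such that `Nm Φ_k` pairs to `1` with the image of `c_k`. For
even `k` the pairing is carried to `k + 1` by `Nm = M D`, for odd `k` by the Stokes formula alone.
-/
lemma exists_reduced_fundChain_eq_one {s : List (Option (ZMod p)) → ZMod p} {n : ℕ}
    (hnone : ∀ x, s (none :: x) = s x)
    (hs : ∀ x g h, x.length ≤ n → some h ∈ x → s (g +ᵥ x) = g + s x) (k : ℕ) (hk : k + 1 ≤ n) :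
    ∃ Φ : List (ZMod p) → ZMod p, Reduced Φ ∧
      convOp (altWt p (k + 1)) (fun l => cobdry l Φ) = 0 ∧
      fundChain k (chainSum s (k + 1) (convOp 1 Φ)) = 1 := by
  induction k with
  | zero =>
    -- The augmentation: `Nm Φ₀ = δ Ψ` is the constant `1` on single signs.
    let Ψ : List (ZMod p) → ZMod p := fun l => if l = [] then 1 else 0
    have hΨ : Reduced Ψ := fun l hl => if_neg fun h : l = [] => hl (by simp [h])
    have hD : convOp (diffWt p) (fun l => cobdry l Ψ) = 0 := by
      funext l
      rw [convOp_diffWt, cobdry_vadd, Pi.zero_apply, sub_eq_zero]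
      congr 1
      funext l'
      cases l' <;> simp [Ψ]
    obtain ⟨Φ, h1, h2⟩ := exists_convOp_one_eq hΨ.cobdry rfl hD
    refine ⟨Φ, h1, ?_, ?_⟩
    · funext l
      rw [altWt_odd (by simp), ← cobdry_convOp, h2, cobdry_cobdry, Pi.zero_apply]
    · rw [h2]
      simp [fundChain, chainSum, bdry, cobdry, Ψ]
  | succ k ih =>
    obtain ⟨Φ, h1, h2, h3⟩ := ih (by omega)
    obtain ⟨Ψ, g1, g2, g3⟩ := exists_next_cochain k h1 h2
    refine ⟨Ψ, g1, g3, ?_⟩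
    by_cases he : Even k
    · rw [altWt_even he] at g2
      have : convOp 1 Ψ = fun l => cobdry l (convOp (momentWt p) Φ) := by
        funext l
        rw [← convOp_diffWt_momentWt, convOp_comm, g2, cobdry_convOp]
      rw [this, fundChain_chainSum_cobdry hnone hs (by omega), altWt_even he,
        convOp_diffWt_momentWt, h3]
    · rw [altWt_odd he] at g2
      rw [g2, fundChain_chainSum_cobdry hnone hs (by omega), altWt_odd he, h3]

/-- Pigeonhole for levels: below a vector of level `ℓ` and sign `g` there are only `ℓ - 1` further
levels, so a chain of `ℓ` vectors below it, preceded by `g`, repeats a level and therefore has two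
equal neighbouring signs. -/
lemma chainSum_eq_zero_of_level_le {s : List (Option (ZMod p)) → ZMod p}
    {lvl : List (Option (ZMod p)) → ℕ} {n : ℕ}
    (hpos : ∀ x, x.length ≤ n → (∃ h, some h ∈ x) → 0 < lvl x)
    (hmono : ∀ x y, x.length ≤ n → IsFace y x → (∃ h, some h ∈ y) →
      lvl y ≤ lvl x ∧ (lvl y = lvl x → s y = s x))
    (k ℓ : ℕ) (hℓ : 0 < ℓ) (hk : ℓ ≤ k) (g : ZMod p) (Φ : List (ZMod p) → ZMod p)
    (hΦ : ∀ l, ¬ (g :: l).IsChain (· ≠ ·) → Φ l = 0) (x : List (Option (ZMod p)))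
    (hx : x.length ≤ n) (hxl : (∃ h, some h ∈ x) → lvl x ≤ ℓ ∧ (lvl x = ℓ → s x = g)) :
    chainSum s k Φ x = 0 := by
  induction k generalizing ℓ g Φ x with
  | zero => omega
  | succ k ih =>
    simp only [chainSum]
    by_cases h : ∃ h, some h ∈ x
    · obtain ⟨hle, heq⟩ := hxl h
      rw [← bdry_zero x]
      refine bdry_congr x fun y hy => ?_
      rcases hle.eq_or_lt with hl | hl
      · have : (fun l => Φ (s x :: l)) = fun _ => 0 := by
          funext l
          exact hΦ _ (by simp [heq hl])
        rw [this, chainSum_zero]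
      · exact ih (lvl x) (hpos x hx h) (by omega) (s x) _
          (fun l hc => hΦ _ fun hc' => hc hc'.tail) y (hy.length ▸ hx) (hmono x y hx hy)
    · push Not at h
      exact bdry_eq_zero_of_forall_none x h _

/-- Tucker lemma for sign vectors of length at most `n`. -/
theorem length_le_of_labelling {s : List (Option (ZMod p)) → ZMod p}
    {lvl : List (Option (ZMod p)) → ℕ} {n m : ℕ}
    (hnone : ∀ x, s (none :: x) = s x)
    (hs : ∀ x g h, x.length ≤ n → some h ∈ x → s (g +ᵥ x) = g + s x)
    (hlvl : ∀ x, x.length ≤ n → (∃ h, some h ∈ x) → 0 < lvl x ∧ lvl x ≤ m)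
    (hmono : ∀ x y, x.length ≤ n → IsFace y x → (∃ h, some h ∈ y) →
      lvl y ≤ lvl x ∧ (lvl y = lvl x → s y = s x)) : n ≤ m := by
  by_contra! hmn
  obtain ⟨k, rfl⟩ : ∃ k, n = k + 1 := ⟨n - 1, by omega⟩
  obtain ⟨Φ, h1, -, h3⟩ := exists_reduced_fundChain_eq_one hnone hs k le_rfl
  rw [fundChain_congr k (b := fun _ => 0), fundChain_zero] at h3
  · exact zero_ne_one h3
  intro x hx
  simp only [chainSum]
  by_cases h : ∃ h, some h ∈ x
  · rw [← bdry_zero x]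
    refine bdry_congr x fun y hy => ?_
    exact chainSum_eq_zero_of_level_le (fun x hx h => (hlvl x hx h).1) hmono k (lvl x)
      (hlvl x hx.le h).1 (by have := (hlvl x hx.le h).2; omega) (s x) _
      (fun l hc => (h1.convOp 1) _ hc) y (hy.length ▸ hx.le) (hmono x y hx.le hy)
  · push Not at h
    exact bdry_eq_zero_of_forall_none x h _

/-! ### The equivariant Tucker lemma -/

/-- The equivariant Tucker lemma for families of disjoint sets: a monotone equivariant labelling of
the nonempty families in `N` needs at least `|N|` levels. -/
theorem card_le_of_labelling {α : Type*} [DecidableEq α] (N : Finset α)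
    (lvl : (ZMod p → Finset α) → ℕ) (s : (ZMod p → Finset α) → ZMod p) (m : ℕ)
    (hlvl : ∀ Z, IsDisjointFamily N Z → (∃ i, (Z i).Nonempty) → 0 < lvl Z ∧ lvl Z ≤ m)
    (hmono : ∀ Z W, IsDisjointFamily N W → Z ≤ W → (∃ i, (Z i).Nonempty) →
      lvl Z ≤ lvl W ∧ (lvl Z = lvl W → s Z = s W))
    (hs : ∀ Z g, IsDisjointFamily N Z → (∃ i, (Z i).Nonempty) →
      s (fun i => Z (i - g)) = g + s Z) : N.card ≤ m := by
  obtain rfl | ⟨a₀, ha₀⟩ := N.eq_empty_or_nonempty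
  · simp
  let e := N.equivFin
  let v : ℕ → α := fun i => if h : i < N.card then e.symm ⟨i, h⟩ else a₀
  have hvN : ∀ i, v i ∈ N := fun i => by
    simp only [v]
    split_ifs
    · exact (e.symm _).2
    · exact ha₀
  have hv : Set.InjOn v (Set.Iio N.card) := by
    intro i hi j hj hij
    simp only [Set.mem_Iio] at hi hj
    simpa [v, hi, hj, Subtype.ext_iff.symm] using hij
  have hfam : ∀ x : List (Option (ZMod p)), x.length ≤ N.card →
      IsDisjointFamily N (toFamily v x) := fun x hx =>
    ⟨fun i a ha => by obtain ⟨j, -, rfl⟩ := exists_of_mem_toFamily ha; exact hvN j,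
      disjoint_toFamily hv hx⟩
  refine length_le_of_labelling (s := fun x => s (toFamily v x))
    (lvl := fun x => lvl (toFamily v x)) (fun x => rfl) ?_ ?_ ?_
  · intro x g h hx hh
    simp only [toFamily_vadd]
    exact hs _ _ (hfam x hx) ⟨h, toFamily_nonempty hh⟩
  · rintro x hx ⟨h, hh⟩
    exact hlvl _ (hfam x hx) ⟨h, toFamily_nonempty hh⟩
  · rintro x y hx hy ⟨h, hh⟩
    exact hmono _ _ (hfam x hx) (toFamily_mono hy) ⟨h, toFamily_nonempty hh⟩

end Labelling

/-! ### Equivariant choice of a sign -/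

section EquivariantChoice

variable {p : ℕ} [Fact p.Prime] {γ : Type*}

lemma eq_of_shift_eq {F : ZMod p → γ} {d : ZMod p} (hd : d ≠ 0)
    (h : (fun i => F (i - d)) = F) (i j : ZMod p) : F i = F j := by
  have hnat : ∀ (k : ℕ) (i : ZMod p), F (i - k * d) = F i := by
    intro k
    induction k with
    | zero => simp
    | succ k ih =>
      intro i
      rw [← ih i, ← congrFun h (i - k * d)]
      congr 1
      push_cast
      ring
  rw [← hnat ((i - j) / d).val i, ZMod.natCast_zmod_val, div_mul_cancel₀ _ hd, sub_sub_cancel]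

/-- Since `p` is prime, the shift acts freely on nonconstant functions on `ZMod p`; choosing a
representative in each orbit gives an equivariant map to `ZMod p`. -/
lemma exists_equivariant_choice (p : ℕ) [Fact p.Prime] (γ : Type*) :
    ∃ σ : (ZMod p → γ) → ZMod p, ∀ F, (∃ i j, F i ≠ F j) →
      ∀ g, σ (fun i => F (i - g)) = g + σ F := by
  let S : Setoid (ZMod p → γ) :=
    { r := fun F F' => ∃ g, F' = fun i => F (i - g)
      iseqv :=
        { refl := fun F => ⟨0, by simp⟩
          symm := by
            rintro F _ ⟨g, rfl⟩
            exact ⟨-g, by simp⟩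
          trans := by
            rintro F _ _ ⟨g, rfl⟩ ⟨h, rfl⟩
            exact ⟨g + h, by simp only [sub_sub, add_comm]⟩ } }
  have hout : ∀ F : ZMod p → γ, ∃ g, F = fun i => (Quotient.mk S F).out (i - g) := fun F =>
    Quotient.exact (Quotient.out_eq (Quotient.mk S F))
  choose σ hσ using hout
  refine ⟨σ, fun F ⟨a, b, hab⟩ g => ?_⟩
  by_contra hne
  have hcls : Quotient.mk S (fun i => F (i - g)) = Quotient.mk S F :=
    (Quotient.sound (show S.r F _ from ⟨g, rfl⟩)).symm
  have h1 := hσ fun i => F (i - g)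
  rw [hcls] at h1
  generalize σ (fun i => F (i - g)) = τ at h1 hne
  have hF := hσ F
  set R := (Quotient.mk S F).out
  have key : (fun i => F (i - (g + σ F - τ))) = F := by
    funext i
    have h2 := congrFun h1 (i - (σ F - τ))
    have h3 := congrFun hF i
    rw [show i - (g + σ F - τ) = i - (σ F - τ) - g by ring, h2, h3]
    congr 1
    ring
  exact hab (eq_of_shift_eq (sub_ne_zero.2 (Ne.symm hne)) key a b)

/-- A choice of an index in `ZMod p` that is equivariant on nonconstant functions. Its value on
constant functions is irrelevant. -/
noncomputable def equivariantChoice (F : ZMod p → γ) : ZMod p :=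
  Classical.choose (exists_equivariant_choice p γ) F

lemma equivariantChoice_shift {F : ZMod p → γ} (hF : ∃ i j, F i ≠ F j) (g : ZMod p) :
    equivariantChoice (fun i => F (i - g)) = g + equivariantChoice F :=
  Classical.choose_spec (exists_equivariant_choice p γ) F hF g

end EquivariantChoice

/-! ### Equitable truncation and the sign of a family without coloured members -/

section Truncation

variable {ι : Type*}

/-- Cuts the values of `t` down to at most one more than the minimum: the largest sizes not
exceeding `t` that differ by at most one. -/
noncomputable def equitableTrunc (t : ι → ℕ) (i : ι) : ℕ := min (t i) ((⨅ j, t j) + 1)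

lemma equitableTrunc_le (t : ι → ℕ) (i : ι) : equitableTrunc t i ≤ t i := min_le_left _ _

lemma equitableTrunc_le_succ (t : ι → ℕ) (i j : ι) :
    equitableTrunc t i ≤ equitableTrunc t j + 1 := by
  have : (⨅ j, t j) ≤ t j := ciInf_le' t j
  simp only [equitableTrunc]
  omega

lemma equitableTrunc_mono [Nonempty ι] {t u : ι → ℕ} (h : t ≤ u) :
    equitableTrunc t ≤ equitableTrunc u := by
  intro i
  exact min_le_min (h i) (Nat.succ_le_succ (ciInf_mono (OrderBot.bddBelow _) h))

/-- A constant truncation means that nothing was cut, since the minimum is attained. -/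
lemma equitableTrunc_eq_self [Finite ι] [Nonempty ι] {t : ι → ℕ}
    (h : ∀ i j, equitableTrunc t i = equitableTrunc t j) : equitableTrunc t = t := by
  obtain ⟨j, hj⟩ := exists_eq_ciInf_of_finite (f := t)
  funext i
  have := h i j
  simp only [equitableTrunc, ← hj] at this ⊢
  omega

lemma equitableTrunc_comp_equiv (t : ι → ℕ) (e : ι ≃ ι) (i : ι) :
    equitableTrunc (fun j => t (e j)) i = equitableTrunc t (e i) := by
  simp only [equitableTrunc, e.iInf_comp (g := t)]

end Truncation

section Families

variable {α β ι : Type*} [DecidableEq β]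

lemma IsDisjointFamily.mono {N : Finset α} {Z W : ι → Finset α} (hW : IsDisjointFamily N W)
    (h : Z ≤ W) : IsDisjointFamily N Z :=
  ⟨fun i => (h i).trans (hW.1 i), fun i j hij => (hW.2 hij).mono (h i) (h j)⟩

/-- If all members of `Z` meet the same blocks, then every block that `Z` meets contains a point of
each of the `|ι|` members, so it is full. Hence a larger family that meets no new blocks equals
`Z`. -/
lemma eq_of_image_eq [Fintype ι] {f : α → β} {N : Finset α}
    (hfib : ∀ b, (N.filter (f · = b)).card ≤ Fintype.card ι) {Z W : ι → Finset α}
    (hW : IsDisjointFamily N W) (hZW : Z ≤ W)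
    (himg : ∀ i, (Z i).image f = (W i).image f)
    (hconst : ∀ i j, (Z i).image f = (Z j).image f) : Z = W := by
  classical
  refine le_antisymm hZW fun i a ha => ?_
  by_contra haZ
  have hmem : ∀ j, ∃ z ∈ Z j, f z = f a := fun j => by
    have : f a ∈ (Z j).image f := by
      rw [hconst j i, himg i]
      exact Finset.mem_image_of_mem f ha
    simpa using this
  choose z hz hfz using hmem
  have hzinj : Function.Injective z := fun j k hjk => by
    by_contra hne
    exact Finset.disjoint_left.1 (hW.2 hne) (hZW j (hz j)) (hjk ▸ hZW k (hz k))
  have ha' : a ∉ Finset.univ.image z := by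
    simp only [Finset.mem_image, Finset.mem_univ, true_and, not_exists]
    rintro j rfl
    by_cases hj : j = i
    · exact haZ (hj ▸ hz j)
    · exact Finset.disjoint_left.1 (hW.2 hj) (hZW j (hz j)) ha
  have hsub : insert a (Finset.univ.image z) ⊆ N.filter (f · = f a) := by
    intro x hx
    rw [Finset.mem_filter]
    rcases Finset.mem_insert.1 hx with rfl | hx
    · exact ⟨hW.1 i ha, rfl⟩
    · obtain ⟨j, -, rfl⟩ := Finset.mem_image.1 hx
      exact ⟨hW.1 j (hZW j (hz j)), hfz j⟩
  have := (Finset.card_le_card hsub).trans (hfib (f a))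
  rw [Finset.card_insert_of_notMem ha', Finset.card_image_of_injective _ hzinj,
    Finset.card_univ] at this
  omega

variable {p : ℕ}

/-- The sizes of a largest equitable transversal subfamily of `Z`: the numbers of blocks (fibres of
`f`) that the members meet, truncated. -/
noncomputable def truncCount (f : α → β) (Z : ZMod p → Finset α) : ZMod p → ℕ :=
  equitableTrunc fun i => ((Z i).image f).card

lemma truncCount_mono (f : α → β) {Z W : ZMod p → Finset α} (h : Z ≤ W) :
    truncCount f Z ≤ truncCount f W :=
  equitableTrunc_mono fun i => Finset.card_le_card (Finset.image_subset_image (h i))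

lemma exists_transversal_subfamily (f : α → β) (Z : ZMod p → Finset α) :
    ∃ Y ≤ Z, (∀ i, Set.InjOn f (Y i)) ∧ ∀ i, (Y i).card = truncCount f Z i := by
  have : ∀ i, ∃ y ⊆ Z i, Set.InjOn f y ∧ y.card = truncCount f Z i := fun i => by
    obtain ⟨B, hB, hBc⟩ := Finset.exists_subset_card_eq
      (equitableTrunc_le (fun i => ((Z i).image f).card) i)
    obtain ⟨y, hy, hinj, rfl⟩ := Finset.exists_subset_injOn_image_eq_of_surjOn (f := f) (Z i)
      (t := B) fun b hb => by simpa using hB hb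
    exact ⟨y, hy, hinj, by rw [← Finset.card_image_of_injOn hinj, hBc]; rfl⟩
  choose Y h1 h2 h3 using this
  exact ⟨Y, h1, h2, h3⟩

variable [Fact p.Prime]

lemma IsDisjointFamily.not_constant {N : Finset α} {Z : ZMod p → Finset α}
    (hZ : IsDisjointFamily N Z) (hne : ∃ i, (Z i).Nonempty) : ∃ i j, Z i ≠ Z j := by
  by_contra! h
  obtain ⟨i, hi⟩ := hne
  have := hZ.2 (zero_ne_one : (0 : ZMod p) ≠ 1)
  rw [Function.onFun, h 0 i, h 1 i, Finset.disjoint_self_iff_empty] at this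
  exact hi.ne_empty this

open Classical in
/-- The sign of a family without coloured members, read off from the first nonconstant one among the
truncated sizes, the sets of blocks met, and the family itself. -/
noncomputable def transversalSign (f : α → β) (Z : ZMod p → Finset α) : ZMod p :=
  if ∃ i j, truncCount f Z i ≠ truncCount f Z j then equivariantChoice (truncCount f Z)
  else if ∃ i j, (Z i).image f ≠ (Z j).image f then equivariantChoice fun i => (Z i).image f
  else equivariantChoice Z

lemma truncCount_shift (f : α → β) (Z : ZMod p → Finset α) (g : ZMod p) :
    truncCount f (fun i => Z (i - g)) = fun i => truncCount f Z (i - g) := by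
  funext i
  exact equitableTrunc_comp_equiv (fun i => ((Z i).image f).card) (Equiv.subRight g) i

lemma exists_shift_ne_iff {γ : Type*} (F : ZMod p → γ) (g : ZMod p) :
    (∃ i j, F (i - g) ≠ F (j - g)) ↔ ∃ i j, F i ≠ F j :=
  ⟨fun ⟨i, j, h⟩ => ⟨_, _, h⟩, fun ⟨i, j, h⟩ => ⟨i + g, j + g, by simpa using h⟩⟩

lemma transversalSign_shift (f : α → β) {N : Finset α} {Z : ZMod p → Finset α}
    (hZ : IsDisjointFamily N Z) (hne : ∃ i, (Z i).Nonempty) (g : ZMod p) :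
    transversalSign f (fun i => Z (i - g)) = g + transversalSign f Z := by
  simp only [transversalSign, truncCount_shift]
  simp only [exists_shift_ne_iff (truncCount f Z) g,
    exists_shift_ne_iff (fun i => (Z i).image f) g]
  split_ifs with h1 h2
  · exact equivariantChoice_shift h1 g
  · exact equivariantChoice_shift h2 g
  · exact equivariantChoice_shift (hZ.not_constant hne) g

/-- Comparable families with the same truncated sizes have the same sign. If the sizes are constant,
then both families meet the same blocks, and if those are constant as well, the families agree. -/
lemma transversalSign_eq (f : α → β) {N : Finset α} {Z W : ZMod p → Finset α}
    (hfib : ∀ b, (N.filter (f · = b)).card ≤ p)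
    (hW : IsDisjointFamily N W) (hZW : Z ≤ W) (h : truncCount f Z = truncCount f W) :
    transversalSign f Z = transversalSign f W := by
  simp only [transversalSign, h]
  by_cases h1 : ∃ i j, truncCount f W i ≠ truncCount f W j
  · rw [if_pos h1, if_pos h1]
  rw [if_neg h1, if_neg h1]
  push Not at h1
  have hcard : ∀ i, ((Z i).image f).card = ((W i).image f).card := by
    have hWc : truncCount f W = _ := equitableTrunc_eq_self h1
    have hZc : truncCount f Z = _ := equitableTrunc_eq_self fun i j => by
      have := h1 i j
      rwa [← h] at this
    exact fun i => congrFun (hZc.symm.trans (h.trans hWc)) i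
  have himg : ∀ i, (Z i).image f = (W i).image f := fun i =>
    Finset.eq_of_subset_of_card_le (Finset.image_subset_image (hZW i)) (hcard i).ge
  simp only [himg]
  split_ifs with h2
  · rfl
  push Not at h2
  congr 1
  refine eq_of_image_eq (by simpa [ZMod.card] using hfib) hW hZW himg fun i j => ?_
  rw [himg, himg, h2]

end Families

end ZpTucker

/-! ### The prime case of the partition property -/

open ZpTucker

universe u

/-- Let `r = |ι|`. Given `t` upward closed families `U c` and blocks (fibres of `f`) that have at
most `r` points in `N`: if every equitable collection of `r` pairwise disjoint transversal subsets
of `N` covering all but at most `(r - 1) t` points has a member in some `U c`, then some `U c`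
contains `r` pairwise disjoint subsets of `N`. -/
def TransversalPartitionProperty (α : Type u) (ι : Type*) [Fintype ι] : Prop :=
  ∀ (β : Type u) [DecidableEq β] (f : α → β) (N : Finset α) (t : ℕ) (U : Fin t → Set (Finset α)),
    (∀ c, IsUpperSet (U c)) →
    (∀ b, (N.filter (f · = b)).card ≤ Fintype.card ι) →
    (∀ Y : ι → Finset α, IsDisjointFamily N Y → (∀ i, Set.InjOn f (Y i)) →
      (∀ i j, (Y i).card ≤ (Y j).card + 1) →
      N.card ≤ ∑ i, (Y i).card + (Fintype.card ι - 1) * t → ∃ i c, Y i ∈ U c) →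
    ∃ c, ∃ Z : ι → Finset α, IsDisjointFamily N Z ∧ ∀ i, Z i ∈ U c

namespace TransversalPartitionProperty

section Prime

variable {α : Type u} {p t : ℕ}

open Classical in
/-- One more than the largest colour `c` such that some member of `Z` is in `U c`, and `0` if there
is none. -/
noncomputable def topColor [NeZero p] (U : Fin t → Set (Finset α)) (Z : ZMod p → Finset α) : ℕ :=
  (Finset.univ.filter fun c => ∃ i, Z i ∈ U c).sup fun c => (c : ℕ) + 1

/-- The indices `i` for which `Z i` has the colour counted by `T = c + 1`. -/
def topIndices (U : Fin t → Set (Finset α)) (T : ℕ) (Z : ZMod p → Finset α) (i : ZMod p) : Prop :=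
  ∃ c : Fin t, (c : ℕ) + 1 = T ∧ Z i ∈ U c

variable [NeZero p] {U : Fin t → Set (Finset α)} {Z W : ZMod p → Finset α}

lemma topColor_shift (g : ZMod p) : topColor U (fun i => Z (i - g)) = topColor U Z := by
  unfold topColor
  congr 1
  ext c
  simp only [Finset.mem_filter, Finset.mem_univ, true_and]
  exact ⟨fun ⟨i, hi⟩ => ⟨_, hi⟩, fun ⟨i, hi⟩ => ⟨i + g, by simpa using hi⟩⟩

lemma topColor_mono (hU : ∀ c, IsUpperSet (U c)) (h : Z ≤ W) : topColor U Z ≤ topColor U W := by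
  refine Finset.sup_mono fun c => ?_
  simp only [Finset.mem_filter, Finset.mem_univ, true_and]
  exact fun ⟨i, hi⟩ => ⟨i, hU c (h i) hi⟩

lemma topColor_le : topColor U Z ≤ t := Finset.sup_le fun c _ => c.2

lemma topColor_eq_zero : topColor U Z = 0 ↔ ∀ c i, Z i ∉ U c := by
  simp only [topColor, ← Nat.bot_eq_zero, Finset.sup_eq_bot_iff, Finset.mem_filter,
    Finset.mem_univ, true_and]
  simp only [Nat.bot_eq_zero, Nat.succ_ne_zero, imp_false, not_exists]

lemma exists_topIndices (h : topColor U Z ≠ 0) : ∃ i, topIndices U (topColor U Z) Z i := by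
  classical
  have hne : (Finset.univ.filter fun c => ∃ i, Z i ∈ U c).Nonempty := by
    rw [Finset.nonempty_iff_ne_empty]
    intro h0
    exact h (by simp only [topColor, h0]; rfl)
  obtain ⟨c, hc, hcT⟩ := Finset.exists_mem_eq_sup _ hne fun c : Fin t => (c : ℕ) + 1
  obtain ⟨i, hi⟩ := (Finset.mem_filter.1 hc).2
  exact ⟨i, c, by rw [topColor, hcT], hi⟩

end Prime

/-- The prime case. In a counterexample, families without coloured members would take at most
`|N| - 1 - (p - 1) t` levels, by the size of a largest equitable transversal subfamily, and each
colour `p - 1` further levels, by the number of members of that colour, which lies strictly between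
`0` and `p`. This is one level too few. -/
theorem zmod (α : Type u) (p : ℕ) [Fact p.Prime] : TransversalPartitionProperty α (ZMod p) := by
  classical
  intro β _ f N t U hU hfib hY
  by_contra! hno
  rw [ZMod.card] at hfib hY
  have hp := (Fact.out : p.Prime).two_le
  -- The empty collection is equitable and transversal; it ensures that the subtraction in the
  -- definition of `lvl` is not truncated.
  have hpos : (p - 1) * t < N.card := by
    by_contra! hle
    obtain ⟨i, c, hc⟩ := hY (fun _ => ∅) ⟨fun _ => Finset.empty_subset _, fun _ _ _ => by
      simp [Function.onFun]⟩ (by simp) (by simp) (by simpa using hle)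
    obtain ⟨j, hj⟩ := hno c (fun _ => ∅) ⟨fun _ => Finset.empty_subset _, fun _ _ _ => by
      simp [Function.onFun]⟩
    exact hj hc
  have hunc : ∀ Z : ZMod p → Finset α, IsDisjointFamily N Z → topColor U Z = 0 →
      ∑ i, truncCount f Z i + (p - 1) * t < N.card := by
    intro Z hZ h0
    by_contra! hle
    obtain ⟨Y, hYZ, hinj, hcard⟩ := exists_transversal_subfamily f Z
    obtain ⟨i, c, hc⟩ := hY Y (hZ.mono hYZ) hinj
      (fun i j => by rw [hcard, hcard]; exact equitableTrunc_le_succ _ i j)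
      (by simpa only [hcard] using hle)
    exact topColor_eq_zero.1 h0 c i (hU c (hYZ i) hc)
  let S : (ZMod p → Finset α) → ZMod p → Prop := fun Z => topIndices U (topColor U Z) Z
  let lvl : (ZMod p → Finset α) → ℕ := fun Z =>
    if topColor U Z = 0 then ∑ i, truncCount f Z i
    else (N.card - 1 - (p - 1) * t) + (p - 1) * (topColor U Z - 1) +
      (Finset.univ.filter (S Z)).card
  let s : (ZMod p → Finset α) → ZMod p := fun Z =>
    if topColor U Z = 0 then transversalSign f Z else equivariantChoice (S Z)
  have hSpos : ∀ Z, topColor U Z ≠ 0 → 0 < (Finset.univ.filter (S Z)).card := by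
    intro Z h
    obtain ⟨i, hi⟩ := exists_topIndices h
    exact Finset.card_pos.2 ⟨i, by simpa using hi⟩
  have hSne : ∀ Z, IsDisjointFamily N Z → topColor U Z ≠ 0 → ∃ i, ¬ S Z i := by
    intro Z hZ h
    obtain ⟨-, c, hcT, -⟩ := exists_topIndices h
    obtain ⟨i, hi⟩ := hno c Z hZ
    refine ⟨i, fun ⟨c', hc', hi'⟩ => hi ?_⟩
    obtain rfl : c' = c := Fin.ext (by omega)
    exact hi'
  have hSlt : ∀ Z, IsDisjointFamily N Z → topColor U Z ≠ 0 →
      (Finset.univ.filter (S Z)).card ≤ p - 1 := by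
    intro Z hZ h
    obtain ⟨i, hi⟩ := hSne Z hZ h
    have : (Finset.univ.filter (S Z)).card < (Finset.univ : Finset (ZMod p)).card :=
      Finset.card_lt_card ⟨Finset.filter_subset _ _, fun hsub =>
        hi (Finset.mem_filter.1 (hsub (Finset.mem_univ i))).2⟩
    rw [Finset.card_univ, ZMod.card] at this
    omega
  have hstep : ∀ T T' : ℕ, T < T' → T ≠ 0 →
      (p - 1) * (T - 1) + (p - 1) ≤ (p - 1) * (T' - 1) := by
    intro T T' h h0
    rw [← Nat.mul_succ]
    exact Nat.mul_le_mul_left _ (by omega)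
  have hcard := card_le_of_labelling N lvl s (N.card - 1) ?_ ?_ ?_
  · omega
  · intro Z hZ ⟨i, hi⟩
    simp only [lvl]
    split_ifs with h0
    · constructor
      · refine Finset.sum_pos' (fun _ _ => Nat.zero_le _) ⟨i, Finset.mem_univ i, ?_⟩
        have : 0 < ((Z i).image f).card := Finset.card_pos.2 (hi.image f)
        simp only [truncCount, equitableTrunc]
        omega
      · have := hunc Z hZ h0
        omega
    · have h1 := hSpos Z h0
      have h2 := hSlt Z hZ h0
      have h3 := hstep (topColor U Z) (t + 1) (Nat.lt_succ_of_le topColor_le) h0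
      rw [Nat.add_sub_cancel] at h3
      omega
  · intro Z W hW hZW hne
    have hT := topColor_mono hU hZW
    have hZ := hW.mono hZW
    simp only [lvl, s]
    by_cases hW0 : topColor U W = 0
    · have hZ0 : topColor U Z = 0 := by omega
      rw [if_pos hW0, if_pos hZ0, if_pos hW0, if_pos hZ0]
      have hle := truncCount_mono f hZW
      refine ⟨Finset.sum_le_sum fun i _ => hle i, fun heq => ?_⟩
      refine transversalSign_eq f hfib hW hZW (funext fun i => ?_)
      exact (Finset.sum_eq_sum_iff_of_le fun i _ => hle i).1 heq i (Finset.mem_univ i)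
    rw [if_neg hW0, if_neg hW0]
    have hWS := hSpos W hW0
    by_cases hZ0 : topColor U Z = 0
    · rw [if_pos hZ0, if_pos hZ0]
      have := hunc Z hZ hZ0
      exact ⟨by omega, fun h => by omega⟩
    rw [if_neg hZ0, if_neg hZ0]
    have hZS := hSlt Z hZ hZ0
    rcases hT.eq_or_lt with hT | hT
    · have hsub : Finset.univ.filter (S Z) ⊆ Finset.univ.filter (S W) := by
        intro i
        simp only [Finset.mem_filter, Finset.mem_univ, true_and, S, hT]
        exact fun ⟨c, hc, hi⟩ => ⟨c, hc, hU c (hZW i) hi⟩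
      have := Finset.card_le_card hsub
      rw [hT]
      refine ⟨by omega, fun h => ?_⟩
      have heq := Finset.eq_of_subset_of_card_le hsub (by omega)
      congr 1
      funext i
      have := Finset.ext_iff.1 heq i
      simpa using this
    · have := hstep _ _ hT hZ0
      exact ⟨by omega, fun h => by omega⟩
  · intro Z g hZ hne
    simp only [s, S, topColor_shift]
    split_ifs with h0
    · exact transversalSign_shift f hZ hne g
    · refine equivariantChoice_shift (F := S Z) ?_ g
      obtain ⟨i, hi⟩ := exists_topIndices h0
      obtain ⟨j, hj⟩ := hSne Z hZ h0
      exact ⟨i, j, fun h => hj (h ▸ hi)⟩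

end TransversalPartitionProperty

/-! ### Products of index types and the general case -/

/-- Removing points one by one from a largest member keeps a family equitable. -/
lemma exists_equitable_subfamily {α ι : Type*} [Fintype ι] (Z : ι → Finset α)
    (hZ : ∀ i j, (Z i).card ≤ (Z j).card + 1) {m : ℕ} (hm : m ≤ ∑ i, (Z i).card) :
    ∃ Y ≤ Z, (∀ i j, (Y i).card ≤ (Y j).card + 1) ∧ ∑ i, (Y i).card = m := by
  classical
  induction hd : ∑ i, (Z i).card - m generalizing Z with
  | zero => exact ⟨Z, le_rfl, hZ, by omega⟩
  | succ d ih =>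
    have hne : (Finset.univ : Finset ι).Nonempty := by
      rw [Finset.nonempty_iff_ne_empty]
      intro h
      rw [h, Finset.sum_empty] at hd
      omega
    obtain ⟨i₀, -, hmax⟩ := Finset.exists_max_image Finset.univ (fun i => (Z i).card) hne
    have hpos : (Z i₀).Nonempty := by
      rw [← Finset.card_pos]
      by_contra! h0
      have : ∑ i, (Z i).card = 0 :=
        Finset.sum_eq_zero fun i hi => by have := hmax i hi; omega
      omega
    obtain ⟨a, ha⟩ := hpos
    let Z' := Function.update Z i₀ ((Z i₀).erase a)
    have hle : Z' ≤ Z := update_le_self_iff.2 (Finset.erase_subset _ _)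
    have hcard₀ : (Z' i₀).card + 1 = (Z i₀).card := by
      simp only [Z', Function.update_self]
      exact Finset.card_erase_add_one ha
    have hcard : ∀ j, j ≠ i₀ → (Z' j).card = (Z j).card := fun j hj => by
      simp only [Z', Function.update_of_ne hj]
    have hsum : ∑ i, (Z' i).card + 1 = ∑ i, (Z i).card := by
      rw [← Finset.add_sum_erase _ _ (Finset.mem_univ i₀),
        ← Finset.add_sum_erase (a := i₀) _ (fun i => (Z i).card) (Finset.mem_univ i₀),
        ← hcard₀, Finset.sum_congr rfl fun j hj => hcard j (Finset.ne_of_mem_erase hj)]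
      omega
    obtain ⟨Y, hY, h1, h2⟩ := ih Z' (fun i j => by
      have h1 := hmax i (Finset.mem_univ i)
      have h2 := hZ i j
      by_cases hi : i = i₀ <;> by_cases hj : j = i₀
      · rw [hi, hj]; omega
      · subst hi; rw [hcard j hj]; omega
      · subst hj; rw [hcard i hi]; omega
      · rw [hcard i hi, hcard j hj]; omega) (by omega) (by omega)
    exact ⟨Y, hY.trans hle, h1, h2⟩

lemma le_add_one_of_sum_le {ι : Type*} [Fintype ι] {a b : ι → ℕ}
    (ha : ∀ i j, a i ≤ a j + 1) (hb : ∀ i j, b i ≤ b j + 1) (h : ∑ i, a i ≤ ∑ i, b i + 1)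
    (i j : ι) : a i ≤ b j + 1 := by
  by_contra! hlt
  have h1 : ∑ _k : ι, (b j + 1) < ∑ k, a k :=
    Finset.sum_lt_sum (fun k _ => by have := ha i k; omega) ⟨i, Finset.mem_univ i, hlt⟩
  have h2 : ∑ k, b k < ∑ _k : ι, (b j + 1) :=
    Finset.sum_lt_sum (fun k _ => hb k j) ⟨j, Finset.mem_univ j, Nat.lt_succ_self _⟩
  omega

/-- If the blocks have at most `q r` points in `N`, they can be cut into pieces of at most `r`
points each, at most `q` pieces per block. A set transversal to the pieces then has at most `q`
points in each block. -/
lemma exists_fibre_refinement {α : Type*} {β : Type u} [DecidableEq β] (f : α → β) (N : Finset α)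
    {q r : ℕ} (hr : 0 < r) (hf : ∀ b, (N.filter (f · = b)).card ≤ q * r) :
    ∃ g : α → β × ℕ, (∀ b, (N.filter (g · = b)).card ≤ r) ∧
      ∀ Y ⊆ N, Set.InjOn g Y → ∀ b, (Y.filter (f · = b)).card ≤ q := by
  classical
  have hidx : ∀ b, ∃ e : α → ℕ, Set.InjOn e (N.filter (f · = b)) ∧
      ∀ a ∈ N.filter (f · = b), e a < q * r := by
    intro b
    refine ⟨fun a => if h : a ∈ N.filter (f · = b) then
      ((N.filter (f · = b)).equivFin ⟨a, h⟩ : ℕ) else 0, ?_, ?_⟩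
    · intro x hx y hy hxy
      simp only [dif_pos (Finset.mem_coe.1 hx), dif_pos (Finset.mem_coe.1 hy)] at hxy
      simpa using (Finset.equivFin _).injective (Fin.ext hxy)
    · intro a ha
      simp only [dif_pos ha]
      exact (Fin.is_lt _).trans_le (hf b)
  choose e hinj hlt using hidx
  refine ⟨fun a => (f a, e (f a) a / r), fun ⟨b, k⟩ => ?_, fun Y hY hg b => ?_⟩
  · have : Set.MapsTo (e b) (N.filter fun a => (f a, e (f a) a / r) = (b, k))
        (Finset.Ico (k * r) (k * r + r)) := by
      intro a ha
      simp only [Finset.coe_filter, Set.mem_ofPred_eq, Prod.mk.injEq] at ha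
      obtain ⟨-, rfl, rfl⟩ := ha
      rw [Finset.coe_Ico, Set.mem_Ico]
      exact ⟨Nat.div_mul_le_self _ _, by
        have := Nat.lt_div_mul_add (a := e (f a) a) hr; omega⟩
    have := Finset.card_le_card_of_injOn (e b) this ((hinj b).mono fun a ha => by
      simp only [Finset.coe_filter, Set.mem_ofPred_eq, Prod.mk.injEq] at ha ⊢
      exact ⟨ha.1, ha.2.1⟩)
    simpa using this
  · have hmaps : Set.MapsTo (fun a => e b a / r) (Y.filter (f · = b)) (Finset.range q) := by
      intro a ha
      simp only [Finset.coe_filter, Set.mem_ofPred_eq] at ha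
      rw [Finset.coe_range, Set.mem_Iio]
      exact Nat.div_lt_of_lt_mul (by
        rw [mul_comm]; exact hlt b a (Finset.mem_filter.2 ⟨hY ha.1, ha.2⟩))
    have := Finset.card_le_card_of_injOn _ hmaps fun x hx y hy hxy => by
      simp only [Finset.coe_filter, Set.mem_ofPred_eq] at hx hy
      refine hg hx.1 hy.1 ?_
      simp only [hx.2, hy.2]
      exact congrArg _ hxy
    simpa using this

namespace TransversalPartitionProperty

variable {α : Type u} {ι κ : Type*} [Fintype ι] [Fintype κ]

theorem of_equiv (h : TransversalPartitionProperty α ι) (e : ι ≃ κ) :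
    TransversalPartitionProperty α κ := by
  intro β _ f N t U hU hfib hY
  rw [← Fintype.card_congr e] at hfib hY
  have hfam : ∀ Y : ι → Finset α, IsDisjointFamily N Y → IsDisjointFamily N (Y ∘ e.symm) :=
    fun Y hY => ⟨fun i => hY.1 _, fun i j hij => hY.2 (e.symm.injective.ne hij)⟩
  obtain ⟨c, Z, hZ, hZc⟩ := h β f N t U hU hfib fun Y h1 h2 h3 h4 => by
    obtain ⟨i, c, hc⟩ := hY (Y ∘ e.symm) (hfam Y h1) (fun i => h2 _) (fun i j => h3 _ _)
      (by simpa only [Function.comp_apply, Equiv.sum_comp e.symm fun i => (Y i).card] using h4)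
    exact ⟨_, c, hc⟩
  exact ⟨c, Z ∘ e.symm, hfam Z hZ, fun i => hZc _⟩

theorem of_unique [Unique ι] : TransversalPartitionProperty α ι := by
  intro β _ f N t U hU hfib hY
  have hfam : IsDisjointFamily N fun _ : ι => N :=
    ⟨fun _ => le_rfl, fun i j hij => absurd (Subsingleton.elim i j) hij⟩
  obtain ⟨i, c, hc⟩ := hY (fun _ => N) hfam (fun _ x hx y hy hxy => by
    rw [Fintype.card_unique] at hfib
    exact Finset.card_le_one.1 (hfib (f y)) x (by simpa using ⟨hx, hxy⟩) y (by simpa using hy))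
    (by simp) (by simp)
  exact ⟨c, fun _ => N, hfam, fun _ => hc⟩

/-- The property passes to products. Apply it for `κ` to the families of sets containing `|ι|`
disjoint sets from `U c`, with refined blocks. A set outside these families has, by the property for
`ι`, an equitable collection of transversal subsets outside all `U c`; trimming so that exactly
`(|ι| - 1) t` points are lost (or all, if there are fewer) makes these collections jointly
equitable. -/
theorem prod [Nonempty ι] [Nonempty κ] (hι : TransversalPartitionProperty α ι)
    (hκ : TransversalPartitionProperty α κ) : TransversalPartitionProperty α (ι × κ) := by
  intro β _ f N t U hU hfib hY
  rw [Fintype.card_prod] at hfib hY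
  obtain ⟨g, hg, hgf⟩ := exists_fibre_refinement f N Fintype.card_pos hfib
  let U' : Fin t → Set (Finset α) := fun c =>
    {M | ∃ X : ι → Finset α, IsDisjointFamily M X ∧ ∀ i, X i ∈ U c}
  have hU' : ∀ c, IsUpperSet (U' c) := fun c M M' hM ⟨X, hX, hXc⟩ =>
    ⟨X, ⟨fun i => (hX.1 i).trans hM, hX.2⟩, hXc⟩
  suffices h : ∃ c, ∃ M : κ → Finset α, IsDisjointFamily N M ∧ ∀ k, M k ∈ U' c by
    obtain ⟨c, M, hM, hMc⟩ := h
    choose X hX hXc using hMc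
    refine ⟨c, fun x => X x.2 x.1, ⟨fun x => ((hX x.2).1 x.1).trans (hM.1 x.2), ?_⟩,
      fun x => hXc x.2 x.1⟩
    rintro ⟨i, k⟩ ⟨j, l⟩ hne
    by_cases hkl : k = l
    · subst hkl
      exact (hX k).2 fun h => hne (Prod.ext h rfl)
    · exact (hM.2 hkl).mono ((hX k).1 i) ((hX l).1 j)
  refine hκ (β × ℕ) g N t U' hU' hg ?_
  intro Y hYN hYg hYeq hYcard
  by_contra! hno
  have hsplit : ∀ k, ∃ Z : ι → Finset α, IsDisjointFamily (Y k) Z ∧ (∀ i, Set.InjOn f (Z i)) ∧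
      (∀ i j, (Z i).card ≤ (Z j).card + 1) ∧
      ∑ i, (Z i).card = (Y k).card - (Fintype.card ι - 1) * t ∧ ∀ i c, Z i ∉ U c := by
    intro k
    by_contra! hk
    obtain ⟨c, Z, hZ, hZc⟩ := hι β f (Y k) t U hU (hgf (Y k) (hYN.1 k) (hYg k)) (by
      intro Z h1 h2 h3 h4
      obtain ⟨Z', hZ', h5, h6⟩ := exists_equitable_subfamily Z h3
        (m := (Y k).card - (Fintype.card ι - 1) * t) (by omega)
      obtain ⟨i, c, hc⟩ := hk Z' (h1.mono hZ') (fun i => (h2 i).mono (by exact_mod_cast hZ' i))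
        h5 h6
      exact ⟨i, c, hU c (hZ' i) hc⟩)
    exact hno k c ⟨Z, hZ, hZc⟩
  choose Z hZY hZf hZeq hZsum hZU using hsplit
  obtain ⟨x, c, hc⟩ := hY (fun x => Z x.2 x.1) ⟨fun x => ((hZY x.2).1 x.1).trans (hYN.1 x.2), by
      rintro ⟨i, k⟩ ⟨j, l⟩ hne
      by_cases hkl : k = l
      · subst hkl
        exact (hZY k).2 fun h => hne (Prod.ext h rfl)
      · exact (hYN.2 hkl).mono ((hZY k).1 i) ((hZY l).1 j)⟩ (fun x => hZf _ _)
    (fun x y => le_add_one_of_sum_le (hZeq x.2) (hZeq y.2) (by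
      rw [hZsum, hZsum]
      have := hYeq x.2 y.2
      omega) x.1 y.1) (by
      have h0 : ∑ x : ι × κ, (Z x.2 x.1).card = ∑ k, ∑ i, (Z k i).card :=
        Fintype.sum_prod_type_right _
      have h1 : ∑ k, (Y k).card ≤ ∑ k, (∑ i, (Z k i).card + (Fintype.card ι - 1) * t) :=
        Finset.sum_le_sum fun k _ => by rw [hZsum]; omega
      rw [Finset.sum_add_distrib, Finset.sum_const, Finset.card_univ, smul_eq_mul] at h1
      have h2 : Fintype.card κ * ((Fintype.card ι - 1) * t) + (Fintype.card κ - 1) * t =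
          (Fintype.card ι * Fintype.card κ - 1) * t := by
        rw [← mul_assoc, ← add_mul]
        congr 1
        have hi : 0 < Fintype.card ι := Fintype.card_pos
        have hk : 0 < Fintype.card κ := Fintype.card_pos
        obtain ⟨a, ha⟩ := Nat.exists_eq_add_of_lt hi
        obtain ⟨b, hb⟩ := Nat.exists_eq_add_of_lt hk
        rw [ha, hb]
        simp only [zero_add, Nat.add_sub_cancel]
        refine (Nat.sub_eq_of_eq_add ?_).symm
        ring
      omega)
  exact hZU _ _ _ hc

theorem fin (α : Type u) (r : ℕ) (hr : r ≠ 0) : TransversalPartitionProperty α (Fin r) := by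
  induction r using induction_on_primes with
  | zero => exact absurd rfl hr
  | one => exact of_unique
  | prime_mul p a hp ih =>
    have : Fact p.Prime := ⟨hp⟩
    have ha : a ≠ 0 := right_ne_zero_of_mul hr
    have : Nonempty (Fin a) := ⟨⟨0, Nat.pos_of_ne_zero ha⟩⟩
    exact ((zmod α p).prod (ih ha)).of_equiv (Fintype.equivFinOfCardEq (by simp [ZMod.card]))

end TransversalPartitionProperty

/-! ### Colourings of the hypergraph -/

lemma AlmostSubset.card_sdiff_le {α : Type*} [DecidableEq α] {s : ℕ} {A B : Finset α}
    (h : AlmostSubset s A B) : (A \ B).card ≤ s := by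
  obtain ⟨E, hE, hAE⟩ := h
  refine (Finset.card_le_card fun a ha => ?_).trans hE
  rw [Finset.mem_sdiff] at ha
  by_contra haE
  exact ha.2 (hAE (Finset.mem_sdiff.2 ⟨ha.1, haE⟩))

/-- A common point of `A` and `B` lies outside `X` or outside `Y`. -/
lemma card_inter_le_of_disjoint {α : Type*} [DecidableEq α] {A B X Y : Finset α}
    (h : Disjoint X Y) : (A ∩ B).card ≤ (A \ X).card + (B \ Y).card := by
  refine (Finset.card_le_card fun a ha => ?_).trans (Finset.card_union_le _ _)
  rw [Finset.mem_inter] at ha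
  rw [Finset.mem_union, Finset.mem_sdiff, Finset.mem_sdiff]
  by_cases haX : a ∈ X
  · exact Or.inr ⟨ha.2, Finset.disjoint_left.1 h haX⟩
  · exact Or.inl ⟨ha.1, haX⟩

/-- If `Y` is transversal to the partition, each part meets `A` in at most one point of `Y`. -/
lemma sum_card_inter_sub_one_le {α : Type*} [DecidableEq α] {N : Finset α} (P : Finpartition N)
    (A Y : Finset α) (hY : ∀ p ∈ P.parts, (Y ∩ p).card ≤ 1) :
    ∑ p ∈ P.parts, ((A ∩ p).card - 1) ≤ (A \ Y).card := by
  have hdisj : ∀ p ∈ P.parts, ∀ q ∈ P.parts, p ≠ q →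
      Disjoint ((A \ Y) ∩ p) ((A \ Y) ∩ q) := fun p hp q hq hpq =>
    (P.disjoint hp hq hpq).mono Finset.inter_subset_right Finset.inter_subset_right
  refine le_trans (Finset.sum_le_sum fun p hp => ?_)
    ((Finset.card_biUnion hdisj).symm.le.trans (Finset.card_le_card (Finset.biUnion_subset.2
      fun p _ => Finset.inter_subset_left)))
  have : A ∩ p ⊆ ((A \ Y) ∩ p) ∪ (Y ∩ p) := by
    intro a
    simp only [Finset.mem_inter, Finset.mem_union, Finset.mem_sdiff]
    tauto
  have h1 := (Finset.card_le_card this).trans (Finset.card_union_le _ _)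
  have h2 := hY p hp
  omega

theorem ecd_le_of_colorable {α : Type*} [Fintype α] [DecidableEq α] {r s t : ℕ} (hr : 2 ≤ r)
    (P : Finpartition (Finset.univ : Finset α)) (hP : ∀ p ∈ P.parts, p.card ≤ r)
    (F : Finset (Finset α)) (hF : ∀ A ∈ F, s < A.card)
    (hcol : (modifiedKneserHypergraph r F P s).Colorable t) : ecd r F (s / 2) ≤ (r - 1) * t := by
  by_contra! hlt
  obtain ⟨col, hcol⟩ := hcol
  let H := modifiedKneserHypergraph r F P s
  -- The sets that contain a vertex of colour `c` up to at most `s / 2` points.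
  let U : Fin t → Set (Finset α) := fun c =>
    {X | ∃ A : H.vertexSet, col A = c ∧ ((A : Finset α) \ X).card ≤ s / 2}
  have hU : ∀ c, IsUpperSet (U c) := fun c X Y hXY ⟨A, hA, hAX⟩ =>
    ⟨A, hA, (Finset.card_le_card (Finset.sdiff_subset_sdiff le_rfl hXY)).trans hAX⟩
  suffices h : ∃ c, ∃ Z : Fin r → Finset α, IsDisjointFamily Finset.univ Z ∧ ∀ i, Z i ∈ U c by
    obtain ⟨c, Z, hZ, hZc⟩ := h
    choose A hAc hAZ using hZc
    have hinter : ∀ i j, i ≠ j → ((A i : Finset α) ∩ A j).card ≤ s := fun i j hij => by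
      have := card_inter_le_of_disjoint (A := (A i : Finset α)) (B := A j) (hZ.2 hij)
      have h1 := hAZ i
      have h2 := hAZ j
      omega
    have hinj : Function.Injective fun i => (A i : Finset α) := fun i j hij => by
      by_contra hne
      have h1 := hinter i j hne
      have h2 := hF _ (A i).2.1
      simp only at hij
      rw [← hij, Finset.inter_self] at h1
      omega
    have hedge : (Set.range fun i => (A i : Finset α)) ∈ H.edgeSet := by
      refine ⟨?_, ?_, ?_⟩
      · rintro _ ⟨i, rfl⟩
        exact (A i).2
      · rw [← Set.image_univ, hinj.encard_image, Set.encard_univ]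
        simp
      · rintro _ ⟨i, rfl⟩ _ ⟨j, rfl⟩ hne
        exact hinter i j fun h => hne (by rw [h])
    obtain ⟨x, y, ⟨i, hi⟩, ⟨j, hj⟩, hxy⟩ := hcol _ hedge
    obtain rfl : A i = x := Subtype.ext hi
    obtain rfl : A j = y := Subtype.ext hj
    exact hxy ((hAc i).trans (hAc j).symm)
  refine TransversalPartitionProperty.fin α r (by omega) (Finset α) P.part
    Finset.univ t U hU ?_ ?_
  · intro b
    rw [Fintype.card_fin]
    by_cases hb : b ∈ P.parts
    · refine (Finset.card_le_card fun a ha => ?_).trans (hP b hb)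
      rw [← (Finset.mem_filter.1 ha).2]
      exact P.mem_part (Finset.mem_univ a)
    · rw [Finset.filter_false_of_mem, Finset.card_empty]
      · exact Nat.zero_le _
      · rintro a - rfl
        exact hb (P.part_mem.2 (Finset.mem_univ a))
  · intro Y hY hinj heq hcard
    rw [Fintype.card_fin, Finset.card_univ] at hcard
    by_contra! hno
    have hdisj : (Finset.univ.biUnion Y).card = ∑ i, (Y i).card :=
      Finset.card_biUnion fun i _ j _ hij => hY.2 hij
    have hmem : ((Finset.univ.biUnion Y)ᶜ).card ∈ {k : ℕ | ∃ (X₀ : Finset α) (X : Fin r → Finset α),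
        X₀.card = k ∧ IsEquitablePartition X₀ᶜ X ∧
        ∀ A ∈ F, ∀ i, ¬ AlmostSubset (s / 2) A (X i)} := by
      refine ⟨_, Y, rfl, ⟨fun i j hij => hY.2 hij, by rw [compl_compl], heq⟩, ?_⟩
      intro A hA i hAi
      have hAY := hAi.card_sdiff_le
      have hv : A ∈ H.vertexSet := by
        refine ⟨hA, (sum_card_inter_sub_one_le P A (Y i) fun p hp => ?_).trans hAY⟩
        refine Finset.card_le_one.2 fun a ha b hb => ?_
        rw [Finset.mem_inter] at ha hb
        refine hinj i ha.1 hb.1 ?_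
        rw [P.part_eq_of_mem hp ha.2, P.part_eq_of_mem hp hb.2]
      exact hno i (col ⟨A, hv⟩) ⟨⟨A, hv⟩, rfl, hAY⟩
    have := Nat.sInf_le hmem
    rw [Finset.card_compl, hdisj] at this
    have h2 : ecd r F (s / 2) ≤ Fintype.card α - ∑ i, (Y i).card := this
    omega

theorem theorem4 (n r s : ℕ) (hn : 1 ≤ n) (hr : 2 ≤ r)
    (P : Finpartition (Finset.univ : Finset (Fin n))) (hP : ∀ p ∈ P.parts, p.card ≤ r)
    (F : Finset (Finset (Fin n))) (hF : ∀ A ∈ F, s < A.card) :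
    ((⌈(ecd r F (s / 2) : ℚ) / ((r : ℚ) - 1)⌉₊ : ℕ) : ℕ∞) ≤
      (modifiedKneserHypergraph r F P s).chromaticNumber := by
  refine le_iInf₂ fun t ht => ?_
  have hle : ecd r F (s / 2) ≤ (r - 1) * t := ecd_le_of_colorable hr P hP F hF ht
  rw [Nat.cast_le, Nat.ceil_le]
  have hr1 : (0 : ℚ) < (r : ℚ) - 1 := by
    have : (2 : ℚ) ≤ r := by exact_mod_cast hr
    linarith
  rw [div_le_iff₀ hr1, mul_comm]
  have : ((ecd r F (s / 2) : ℕ) : ℚ) ≤ ((r - 1) * t : ℕ) := by exact_mod_cast hle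
  rwa [Nat.cast_mul, Nat.cast_sub (by omega), Nat.cast_one] at this
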